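/- Let $dA=\pi^{-1}\,dx\,dy$ be the normalized area measure on $\mathbb C$. Let $Q:\mathbb C\to\mathbb R$ be $C^2$-smooth and suppose that for some $\epsilon,R>0$ we have $Q(z)\ge(1+\epsilon)\log|z|^2$ for all $|z|\ge R$. Let $\widehat Q$ be the equilibrium weight, i.e. the largest subharmonic function in $\mathbb C$ that is $\le Q$ everywhere and satisfies $\widehat Q(z)=\log|z|^2+O(1)$ as $|z|\to\infty$ (the pointwise supremum of all such minorants of $Q$), and let $\mathcal S=\{z: Q(z)=\widehat Q(z)\}$. For real $m\ge 1$ and an integer $n\ge 0$, let $A^2_{2,mQ,n}$ be the space of all $u\in\operatorname{span}_{\mathbb C}\{\bar z^r z^j: 0\le r\le 1,\ 0\le j\le n-1\}$ with $\|u\|_{mQ}^2:=\int_{\mathbb C}|u|^2e^{-mQ}\,dA<\infty$, and let $K_{2,mQ,n}(z,w)=\sum_j e_j(z)\overline{e_j(w)}$ be its reproducing kernel, where $(e_j)$ is any orthonormal basis of $A^2_{2,mQ,n}$ in $L^2(e^{-mQ}dA)$. Then there is a constant $C>0$ depending only on $Q$ such that for all real $m\ge1$ and all integers $0\le n\le m$: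 (i) for all $u\in A^2_{2,mQ,n}$ and all $z\in\mathbb C$, $$|u(z)|^2\le C m^2\,\|u\|_{mQ}^2\,e^{m\widehat Q(z)};$$ (ii) for all $z\in\mathbb C$, $$K_{2,mQ,n}(z,z)\,e^{-mQ(z)}\le C m^2\,e^{-m(Q(z)-\widehat Q(z))}.$$ Consequently, the one-point function decays exponentially off $\mathcal S$: for every $z\in\mathbb C\setminus\mathcal S$ there are $c,C'>0$, depending only on $Q$ and $z$, such that $K_{2,mQ,n}(z,z)e^{-mQ(z)}\le C'e^{-cm}$ for all real $m\ge1$ and all integers $0\le n\le m$. -/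

import Mathlib

namespace Polyanalytic

open MeasureTheory ComplexConjugate

/-- A growth condition on the weight:
`Q(z) ≥ (1 + ε) log |z|²` for `|z| ≥ R`, for some positive `ε` and `R`. -/
def WeightGrowth (Q : ℂ → ℝ) : Prop :=
  ∃ ε : ℝ, 0 < ε ∧ ∃ R : ℝ, 0 < R ∧
    ∀ z : ℂ, R ≤ ‖z‖ → (1 + ε) * Real.log (‖z‖ ^ 2) ≤ Q z

/-- A real-valued subharmonic function in the plane: upper semicontinuous, with the
sub-mean value inequality on all circles. (For a finite-valued subharmonic function the means over
circles are finite; the integrability clause records this, so that the mean is a genuine one.) -/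
def IsSubharmonic (v : ℂ → ℝ) : Prop :=
  UpperSemicontinuous v ∧
    ∀ (z : ℂ) (r : ℝ), 0 < r → CircleIntegrable v z r ∧ v z ≤ Real.circleAverage v z r

/-- `v(z) = log |z|² + O(1)` as `|z| → ∞`. -/
def HasLogGrowth (v : ℂ → ℝ) : Prop :=
  (fun z : ℂ => v z - Real.log (‖z‖ ^ 2)) =O[Bornology.cobounded ℂ] (fun _ => (1 : ℝ))

/-- The competitors for the equilibrium weight: the subharmonic functions in the plane that are
`≤ Q` everywhere and equal to `log |z|² + O(1)` at infinity. -/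
def subharmonicMinorants (Q : ℂ → ℝ) : Set (ℂ → ℝ) :=
  {v | IsSubharmonic v ∧ (∀ z, v z ≤ Q z) ∧ HasLogGrowth v}

/-- The equilibrium weight `Q̂`: the upper envelope of the competitors. The largest competitor
is this function, see `equilibriumWeight_eq_of_isGreatest`. -/
noncomputable def equilibriumWeight (Q : ℂ → ℝ) (z : ℂ) : ℝ :=
  sSup ((fun v : ℂ → ℝ => v z) '' subharmonicMinorants Q)

theorem equilibriumWeight_eq_of_isGreatest {Q v : ℂ → ℝ}
    (hv : IsGreatest (subharmonicMinorants Q) v) : v = equilibriumWeight Q := by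
  funext z
  have h : IsGreatest ((fun v : ℂ → ℝ => v z) '' subharmonicMinorants Q) (v z) := by
    refine ⟨⟨v, hv.1, rfl⟩, ?_⟩
    rintro _ ⟨w, hw, rfl⟩
    exact hv.2 hw z
  exact h.csSup_eq.symm

/-- The coincidence set (droplet) `S = {Q = Q̂}`. -/
def droplet (Q : ℂ → ℝ) : Set ℂ := {z | Q z = equilibriumWeight Q z}

/-- The measure `e^{-mQ} dA`, where `dA = π⁻¹ dx dy`. -/
noncomputable def weightedMeasure (Q : ℂ → ℝ) (m : ℝ) : Measure ℂ :=
  (ENNReal.ofReal Real.pi⁻¹ • (volume : Measure ℂ)).withDensity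
    (fun z => ENNReal.ofReal (Real.exp (-(m * Q z))))

/-- `‖u‖²_{mQ} = ∫ |u|² e^{-mQ} dA`. -/
noncomputable def weightedNormSq (Q : ℂ → ℝ) (m : ℝ) (u : ℂ → ℂ) : ℝ :=
  ∫ z, ‖u z‖ ^ 2 ∂weightedMeasure Q m

/-- The inner product `∫ u v̄ e^{-mQ} dA` of `L²(e^{-mQ})`. -/
noncomputable def weightedInner (Q : ℂ → ℝ) (m : ℝ) (u v : ℂ → ℂ) : ℂ :=
  ∫ z, u z * conj (v z) ∂weightedMeasure Q m

/-- `Pol_{q,n}`: the complex span of `z̄ ^ r z ^ j`, `0 ≤ r ≤ q - 1`, `0 ≤ j ≤ n - 1`. -/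
def Pol (q n : ℕ) : Submodule ℂ (ℂ → ℂ) :=
  Submodule.span ℂ {f | ∃ r < q, ∃ j < n, f = fun z : ℂ => conj z ^ r * z ^ j}

/-- `A²_{q,mQ,n} = Pol_{q,n} ∩ L²(e^{-mQ})`. -/
noncomputable def A2 (q : ℕ) (Q : ℂ → ℝ) (m : ℝ) (n : ℕ) : Submodule ℂ (ℂ → ℂ) where
  carrier := {u | u ∈ Pol q n ∧ MemLp u 2 (weightedMeasure Q m)}
  add_mem' hu hv := ⟨add_mem hu.1 hv.1, hu.2.add hv.2⟩
  zero_mem' := ⟨zero_mem _, MemLp.zero⟩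
  smul_mem' c _ hu := ⟨Submodule.smul_mem _ c hu.1, hu.2.const_smul c⟩

/-- `e` is an orthonormal basis of `A²_{q,mQ,n}`. -/
def IsOrthonormalBasis (q : ℕ) (Q : ℂ → ℝ) (m : ℝ) (n : ℕ) {d : ℕ} (e : Fin d → ℂ → ℂ) : Prop :=
  Submodule.span ℂ (Set.range e) = A2 q Q m n ∧
    ∀ i j, weightedInner Q m (e i) (e j) = if i = j then 1 else 0

open scoped Classical in
/-- The reproducing kernel `K_{q,mQ,n}(z,w) = ∑ e_j(z) conj (e_j(w))`, where `(e_j)` is an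
orthonormal basis of `A²_{q,mQ,n}`. For continuous `Q` such a basis exists, and the kernel does not
depend on it: `exists_isOrthonormalBasis`, `bergmanKernel_eq`. -/
noncomputable def bergmanKernel (q : ℕ) (Q : ℂ → ℝ) (m : ℝ) (n : ℕ) (z w : ℂ) : ℂ :=
  if h : ∃ (d : ℕ) (e : Fin d → ℂ → ℂ), IsOrthonormalBasis q Q m n e then
    ∑ j, h.choose_spec.choose j z * conj (h.choose_spec.choose j w)
  else 0

/-- The one-point function `Γ¹_{q,mQ,n}(z) = K_{q,mQ,n}(z,z) e^{-mQ(z)}`; the diagonal values of the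
kernel are real and non-negative, see `bergmanKernel_self`. -/
noncomputable def onePointFunction (q : ℕ) (Q : ℂ → ℝ) (m : ℝ) (n : ℕ) (z : ℂ) : ℝ :=
  (bergmanKernel q Q m n z z).re * Real.exp (-(m * Q z))

theorem continuous_of_mem_Pol {q n : ℕ} {u : ℂ → ℂ} (hu : u ∈ Pol q n) : Continuous u := by
  induction hu using Submodule.span_induction with
  | mem f hf =>
    obtain ⟨r, _, j, _, rfl⟩ := hf
    fun_prop
  | zero => exact continuous_const
  | add f g _ _ hf hg => exact hf.add hg
  | smul c f _ hf => exact hf.const_smul c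

instance finiteDimensional_Pol (q n : ℕ) : FiniteDimensional ℂ (Pol q n) := by
  refine FiniteDimensional.span_of_finite ℂ ?_
  refine ((Set.finite_Iio q).image2 (fun r j => fun z : ℂ => conj z ^ r * z ^ j)
    (Set.finite_Iio n)).subset ?_
  rintro f ⟨r, hr, j, hj, rfl⟩
  exact ⟨r, hr, j, hj, rfl⟩

theorem A2_le_Pol (q : ℕ) (Q : ℂ → ℝ) (m : ℝ) (n : ℕ) : A2 q Q m n ≤ Pol q n := fun _ h => h.1

instance finiteDimensional_A2 (q : ℕ) (Q : ℂ → ℝ) (m : ℝ) (n : ℕ) :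
    FiniteDimensional ℂ (A2 q Q m n) :=
  Submodule.finiteDimensional_of_le (A2_le_Pol q Q m n)

theorem integrable_inner {Q : ℂ → ℝ} {m : ℝ} {u v : ℂ → ℂ}
    (hu : MemLp u 2 (weightedMeasure Q m)) (hv : MemLp v 2 (weightedMeasure Q m)) :
    Integrable (fun z => u z * conj (v z)) (weightedMeasure Q m) :=
  hu.integrable_mul hv.star

theorem ae_volume_of_ae {Q : ℂ → ℝ} (hQ : Continuous Q) {m : ℝ} {p : ℂ → Prop}
    (h : ∀ᵐ z ∂weightedMeasure Q m, p z) : ∀ᵐ z, p z := by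
  have h1 : (volume : Measure ℂ) ≪ ENNReal.ofReal Real.pi⁻¹ • (volume : Measure ℂ) := by
    refine Measure.absolutelyContinuous_smul ?_
    simpa using Real.pi_pos
  have h2 : ENNReal.ofReal Real.pi⁻¹ • (volume : Measure ℂ) ≪ weightedMeasure Q m := by
    refine withDensity_absolutelyContinuous' ?_ ?_
    · exact Measurable.aemeasurable (by fun_prop)
    · exact Filter.Eventually.of_forall fun z => by simpa using Real.exp_pos _
  exact (h1.trans h2).ae_le h

theorem eq_zero_of_weightedInner_self {q : ℕ} {Q : ℂ → ℝ} (hQ : Continuous Q) {m : ℝ} {n : ℕ}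
    {u : ℂ → ℂ} (hu : u ∈ A2 q Q m n) (h : weightedInner Q m u u = 0) : u = 0 := by
  have hi := integrable_inner hu.2 hu.2
  have h0 : ∫ z, ‖u z‖ ^ 2 ∂weightedMeasure Q m = 0 := by
    have : weightedInner Q m u u = ((∫ z, ‖u z‖ ^ 2 ∂weightedMeasure Q m : ℝ) : ℂ) := by
      rw [weightedInner, ← integral_complex_ofReal]
      congr 1; ext z; rw [Complex.mul_conj']; push_cast; rfl
    rw [this] at h; exact_mod_cast h
  rw [integral_eq_zero_iff_of_nonneg (fun z => by positivity) (by simpa using hu.2.integrable_norm_pow two_ne_zero)] at h0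
  have h1 : u =ᵐ[volume] 0 := by
    refine ae_volume_of_ae hQ (h0.mono fun z hz => ?_)
    simpa using hz
  exact (continuous_of_mem_Pol hu.1).ae_eq_iff_eq volume continuous_const |>.1 h1

theorem exists_isOrthonormalBasis (q : ℕ) {Q : ℂ → ℝ} (hQ : Continuous Q) (m : ℝ) (n : ℕ) :
    ∃ (d : ℕ) (e : Fin d → ℂ → ℂ), IsOrthonormalBasis q Q m n e := by
  let core : InnerProductSpace.Core ℂ (A2 q Q m n) :=
    { inner := fun u v => weightedInner Q m v u
      conj_inner_symm := fun u v => by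
        simp only [weightedInner, ← integral_conj]
        congr 1; ext z; simp [mul_comm]
      re_inner_nonneg := fun u => by
        have : weightedInner Q m u u
            = ((∫ z, ‖(u : ℂ → ℂ) z‖ ^ 2 ∂weightedMeasure Q m : ℝ) : ℂ) := by
          rw [weightedInner, ← integral_complex_ofReal]
          congr 1; ext z; rw [Complex.mul_conj']; push_cast; rfl
        rw [this]
        simpa using integral_nonneg fun z => by positivity
      add_left := fun u v w => by
        simp only [weightedInner]
        rw [← integral_add (integrable_inner w.2.2 u.2.2) (integrable_inner w.2.2 v.2.2)]
        congr 1; ext z; simp [mul_add]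
      smul_left := fun u v c => by
        simp only [weightedInner]
        rw [← integral_const_mul]
        congr 1; ext z; simp; ring
      definite := fun u hu => Subtype.ext (eq_zero_of_weightedInner_self hQ u.2 hu) }
  let _ : NormedAddCommGroup (A2 q Q m n) := core.toNormedAddCommGroup
  let _ : InnerProductSpace ℂ (A2 q Q m n) := InnerProductSpace.ofCore core.toCore
  let b := stdOrthonormalBasis ℂ (A2 q Q m n)
  refine ⟨_, fun i => (b i : ℂ → ℂ), ?_, fun i j => ?_⟩
  · have h := congrArg (Submodule.map (A2 q Q m n).subtype) b.toBasis.span_eq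
    rw [Submodule.map_span, Submodule.map_top, Submodule.range_subtype, ← Set.range_comp] at h
    refine Eq.trans ?_ h
    congr 2
  · have h := orthonormal_iff_ite.1 b.orthonormal j i
    rw [show (if i = j then (1 : ℂ) else 0) = if j = i then 1 else 0 by simp [eq_comm]]
    exact h

theorem IsOrthonormalBasis.mem {q : ℕ} {Q : ℂ → ℝ} {m : ℝ} {n d : ℕ} {e : Fin d → ℂ → ℂ}
    (he : IsOrthonormalBasis q Q m n e) (i : Fin d) : e i ∈ A2 q Q m n :=
  he.1 ▸ Submodule.subset_span ⟨i, rfl⟩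

theorem IsOrthonormalBasis.expand {q : ℕ} {Q : ℂ → ℝ} {m : ℝ} {n d : ℕ} {e : Fin d → ℂ → ℂ}
    (he : IsOrthonormalBasis q Q m n e) {u : ℂ → ℂ} (hu : u ∈ A2 q Q m n) :
    u = ∑ i, weightedInner Q m u (e i) • e i := by
  rw [← he.1, Submodule.mem_span_range_iff_exists_fun] at hu
  obtain ⟨c, rfl⟩ := hu
  refine Finset.sum_congr rfl fun i _ => ?_
  congr 1
  have : weightedInner Q m (∑ j, c j • e j) (e i) = ∑ j, c j * weightedInner Q m (e j) (e i) := by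
    simp only [weightedInner, ← integral_const_mul]
    rw [← integral_finsetSum _
      fun j _ => (integrable_inner (he.mem j).2 (he.mem i).2).const_mul _]
    congr 1; ext z; simp [Finset.sum_mul, mul_assoc]
  simp [this, he.2]

theorem weightedInner_conj (Q : ℂ → ℝ) (m : ℝ) (u v : ℂ → ℂ) :
    conj (weightedInner Q m u v) = weightedInner Q m v u := by
  simp only [weightedInner, ← integral_conj]
  congr 1; ext z; simp [mul_comm]

/-- The kernel does not depend on the choice of the orthonormal basis. -/
theorem bergmanKernel_eq {q : ℕ} {Q : ℂ → ℝ} {m : ℝ} {n d : ℕ} {e : Fin d → ℂ → ℂ}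
    (he : IsOrthonormalBasis q Q m n e) (z w : ℂ) :
    bergmanKernel q Q m n z w = ∑ j, e j z * conj (e j w) := by
  have h : ∃ (d : ℕ) (e : Fin d → ℂ → ℂ), IsOrthonormalBasis q Q m n e := ⟨d, e, he⟩
  rw [bergmanKernel, dif_pos h]
  have hf : IsOrthonormalBasis q Q m n h.choose_spec.choose := h.choose_spec.choose_spec
  generalize h.choose_spec.choose = f at hf
  have h1 : ∀ i, f i z = ∑ j, weightedInner Q m (f i) (e j) * e j z := fun i => by
    simpa using congrFun (he.expand (hf.mem i)) z
  have h2 : ∀ j, e j w = ∑ i, weightedInner Q m (e j) (f i) * f i w := fun j => by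
    simpa using congrFun (hf.expand (he.mem j)) w
  simp_rw [h1, Finset.sum_mul]
  rw [Finset.sum_comm]
  refine Finset.sum_congr rfl fun j _ => ?_
  rw [h2 j, map_sum, Finset.mul_sum]
  refine Finset.sum_congr rfl fun i _ => ?_
  rw [map_mul, weightedInner_conj]
  ring

theorem bergmanKernel_self {q : ℕ} {Q : ℂ → ℝ} {m : ℝ} {n d : ℕ} {e : Fin d → ℂ → ℂ}
    (he : IsOrthonormalBasis q Q m n e) (z : ℂ) :
    bergmanKernel q Q m n z z = ((∑ j, ‖e j z‖ ^ 2 : ℝ) : ℂ) := by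
  rw [bergmanKernel_eq he]
  push_cast
  exact Finset.sum_congr rfl fun j _ => Complex.mul_conj' _

end Polyanalytic

/-! ### Weighted Bernstein-Walsh inequality for holomorphic polynomials. -/

namespace Polyanalytic

open MeasureTheory ComplexConjugate Polynomial Real

/-! For a holomorphic polynomial `p` of degree at most `m`, the function `m⁻¹ log (|p|² / M)` is
subharmonic, so a bound by `M e^{mQ}` on a large disc improves to `M e^{mQ̂}` everywhere
(`exists_bernstein_walsh`). A bianalytic `u = f + z̄ g` has no such subharmonicity, so the conjugate
variable is frozen: for fixed `a`, put `p(z) = (f(z) + ā g(z)) (1 + ā z) / (1 + |a|²)`. This is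
holomorphic of degree at most `n`, equals `u(a)` at `z = a`, and its last factor compensates the
growth of `f + ā g` in `a`.

The hypothesis on a disc comes from mean value estimates at scale `m^{-1/2}`
(`exists_weighted_local_estimate`), which control both `u` and `g = ∂̄u`; the bound on `g` is what
costs `m²`. The disc is fixed and the frozen factor is bounded on it uniformly in `a`, so
Bernstein-Walsh can be evaluated at `a` itself (`exists_pointwise_bound`). The kernel bound is
duality, and off the droplet `Q - Q̂ > 0` absorbs `m²`. -/

/-- The logarithm of the modulus of a polynomial satisfies the sub-mean value inequality. -/
theorem log_norm_eval_le_circleAverage (p : ℂ[X]) {z : ℂ} (hp : p.eval z ≠ 0) (r : ℝ) :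
    log ‖p.eval z‖ ≤ circleAverage (fun w => log ‖p.eval w‖) z r := by
  -- After rescaling the circle to the unit one, the claim is that the constant coefficient is at
  -- most the Mahler measure.
  set q : ℂ[X] := p.comp (C (r : ℂ) * X + C z)
  have hq : q.coeff 0 = p.eval z := by simp [q, coeff_zero_eq_eval_zero]
  have h1 : ‖q.coeff 0‖ ≤ q.mahlerMeasure := by
    simpa using q.norm_coeff_le_choose_mul_mahlerMeasure 0
  rw [hq] at h1
  have h2 := Real.log_le_log (norm_pos_iff.2 hp) h1
  rw [← logMahlerMeasure_eq_log_MahlerMeasure, logMahlerMeasure_def] at h2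
  rw [circleAverage_eq_circleAverage_zero_one]
  simpa [q] using h2

theorem le_circleAverage_of_log_norm_le {p : ℂ[X]} {z : ℂ} (hp : p.eval z ≠ 0) {v : ℂ → ℝ}
    (hv : Continuous v) {a b : ℝ} (ha : 0 ≤ a)
    (h : ∀ w, p.eval w ≠ 0 → a * log ‖p.eval w‖ + b ≤ v w) {r : ℝ} (hr : 0 < r) :
    a * log ‖p.eval z‖ + b ≤ circleAverage v z r := by
  have hi : CircleIntegrable (fun w => log ‖p.eval w‖) z r :=
    (analyticOnNhd_id.aeval_polynomial p).meromorphicOn.circleIntegrable_log_norm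
  have hp0 : p ≠ 0 := by rintro rfl; simp at hp
  -- The support may fail at roots of `p`, where `log 0 = 0` is a default value; a circle meets them
  -- in a null set of angles.
  have hae : ∀ᵐ θ : ℝ, p.eval (circleMap z r θ) ≠ 0 := by
    have := ((p.rootSet_finite ℂ).countable.preimage_circleMap z hr.ne').ae_notMem volume
    filter_upwards [this] with θ hθ h0
    exact hθ ((mem_rootSet_of_ne hp0).2 (by simpa using h0))
  have h1 : CircleIntegrable (fun w => a * log ‖p.eval w‖ + b) z r :=
    (hi.const_smul (a := a)).add (circleIntegrable_const b z r)
  have h2 : circleAverage (fun w => a * log ‖p.eval w‖ + b) z r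
      = a * circleAverage (fun w => log ‖p.eval w‖) z r + b := by
    rw [circleAverage_fun_add (f₁ := fun w => a * log ‖p.eval w‖) (hi.const_smul (a := a))
      (circleIntegrable_const b z r), circleAverage_const]
    congr 1
    exact circleAverage_fun_smul (a := a) (f := fun w => log ‖p.eval w‖)
  calc a * log ‖p.eval z‖ + b ≤ a * circleAverage (fun w => log ‖p.eval w‖) z r + b := by
        gcongr
        exact log_norm_eval_le_circleAverage p hp r
    _ = circleAverage (fun w => a * log ‖p.eval w‖ + b) z r := h2.symm
    _ ≤ circleAverage v z r := by
        refine (mul_le_mul_iff_of_pos_left (by simp [pi_pos])).2 ?_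
        refine intervalIntegral.integral_mono_ae two_pi_pos.le h1
          (hv.continuousOn.circleIntegrable hr.le) ?_
        filter_upwards [hae] with θ hθ using h _ hθ

/-- A continuous function with a supporting function `a log |p| + b`, `p` a polynomial, at every
point is subharmonic. -/
theorem isSubharmonic_of_support {v : ℂ → ℝ} (hv : Continuous v)
    (h : ∀ z, ∃ (p : ℂ[X]) (a b : ℝ), 0 ≤ a ∧ p.eval z ≠ 0 ∧ v z = a * log ‖p.eval z‖ + b ∧
      ∀ w, p.eval w ≠ 0 → a * log ‖p.eval w‖ + b ≤ v w) : IsSubharmonic v := by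
  refine ⟨hv.upperSemicontinuous, fun z r hr => ⟨hv.continuousOn.circleIntegrable hr.le, ?_⟩⟩
  obtain ⟨p, a, b, ha, hp, he, hle⟩ := h z
  rw [he]
  exact le_circleAverage_of_log_norm_le hp hv ha hle hr

/-- The maximum of `log⁺ |z|² - c` and `m⁻¹ log (|p|² / M)`. -/
noncomputable def competitor (p : ℂ[X]) (m M c : ℝ) (z : ℂ) : ℝ :=
  max (2 * log⁺ ‖z‖ - c) (m⁻¹ * log (max (‖p.eval z‖ ^ 2 / M) (exp (-(m * c)))))

/-- The floor `exp (-(m * c))` keeps the logarithm finite and continuous across the zeros of `p`. It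
costs nothing, since the other branch of `competitor` is already at least `-c`. -/
theorem neg_le_inv_mul_log (x : ℝ) {m : ℝ} (hm : 0 < m) (c : ℝ) :
    -c ≤ m⁻¹ * log (max x (exp (-(m * c)))) := by
  rw [inv_mul_eq_div, le_div_iff₀ hm, Real.le_log_iff_exp_le (by positivity)]
  exact le_trans (by rw [neg_mul, mul_comm]) (le_max_right _ _)

theorem isSubharmonic_competitor (p : ℂ[X]) {m M : ℝ} (hm : 0 < m) (hM : 0 < M) (c : ℝ) :
    IsSubharmonic (competitor p m M c) := by
  have hcont : Continuous (competitor p m M c) := by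
    unfold competitor
    refine Continuous.max ?_ (continuous_const.mul (Continuous.log ?_ fun z => ?_))
    · have := continuous_posLog.comp (continuous_norm (E := ℂ))
      exact (continuous_const.mul this).sub continuous_const
    · have := p.continuous
      fun_prop
    · exact (lt_max_of_lt_right (exp_pos _)).ne'
  have hlow : ∀ w, -c ≤ competitor p m M c w := fun w =>
    (neg_le_inv_mul_log _ hm c).trans (le_max_right _ _)
  have hconst : ∀ z, competitor p m M c z = -c → ∃ (q : ℂ[X]) (a b : ℝ), 0 ≤ a ∧ q.eval z ≠ 0 ∧
      competitor p m M c z = a * log ‖q.eval z‖ + b ∧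
      ∀ w, q.eval w ≠ 0 → a * log ‖q.eval w‖ + b ≤ competitor p m M c w := fun z hz =>
    ⟨1, 0, -c, le_rfl, by simp, by simp [hz], fun w _ => by simpa using hlow w⟩
  -- The supporting polynomial is `X` where the `log⁺` branch wins outside the unit disc, `p` where
  -- the other branch wins above its floor, and `1` where the minimum `-c` is attained.
  refine isSubharmonic_of_support hcont fun z => ?_
  rcases le_total (m⁻¹ * log (max (‖p.eval z‖ ^ 2 / M) (exp (-(m * c))))) (2 * log⁺ ‖z‖ - c)
    with h | h
  · have hz : competitor p m M c z = 2 * log⁺ ‖z‖ - c := max_eq_left h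
    rcases le_or_gt ‖z‖ 1 with h1 | h1
    · refine hconst z ?_
      rw [hz, (posLog_eq_zero_iff _).2 (by simpa using h1)]; ring
    · have h0 : z ≠ 0 := by rintro rfl; simp at h1; linarith
      refine ⟨X, 2, -c, by norm_num, by simpa using h0, ?_, fun w _ => ?_⟩
      · rw [hz, posLog_eq_log (by simpa using h1.le), eval_X]; ring
      · refine le_trans ?_ (le_max_left _ _)
        have : log ‖w‖ ≤ log⁺ ‖w‖ := le_max_right _ _
        rw [eval_X]; linarith
  · have hz : competitor p m M c z = _ := max_eq_right h
    rcases le_or_gt (‖p.eval z‖ ^ 2 / M) (exp (-(m * c))) with h1 | h1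
    · refine hconst z ?_
      rw [hz, max_eq_right h1, log_exp]
      field_simp
    · have hpos : 0 < ‖p.eval z‖ ^ 2 / M := (exp_pos _).trans h1
      have hp : p.eval z ≠ 0 := by
        intro h0; simp [h0] at hpos
      have key : ∀ w, p.eval w ≠ 0 → 2 * m⁻¹ * log ‖p.eval w‖ + -(m⁻¹ * log M)
          = m⁻¹ * log (‖p.eval w‖ ^ 2 / M) := fun w hw => by
        rw [log_div (by positivity) hM.ne', log_pow]; push_cast; ring
      refine ⟨p, 2 * m⁻¹, -(m⁻¹ * log M), by positivity, hp, ?_, fun w hw => ?_⟩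
      · rw [hz, max_eq_left h1.le, key z hp]
      · refine le_trans ?_ (le_max_right _ _)
        rw [key w hw]
        have : 0 < ‖p.eval w‖ ^ 2 / M := by positivity
        gcongr
        exact le_max_left _ _

/-- The Bernstein-Walsh inequality for the unit disc. -/
theorem norm_eval_le_of_unit_circle {p : ℂ[X]} {n : ℕ} (hn : p.natDegree ≤ n) {B : ℝ}
    (hB : ∀ z : ℂ, ‖z‖ = 1 → ‖p.eval z‖ ≤ B) {z : ℂ} (hz : 1 ≤ ‖z‖) :
    ‖p.eval z‖ ≤ B * ‖z‖ ^ n := by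
  -- The reversed polynomial carries the exterior of the disc to its interior, where the maximum
  -- principle applies.
  have hr : ∀ w : ℂ, w ≠ 0 → (p.reflect n).eval w⁻¹ * w ^ n = p.eval w := fun w hw => by
    let _ := invertibleOfNonzero hw
    have := eval₂_reflect_mul_pow (RingHom.id ℂ) w n p hn
    rwa [invOf_eq_inv] at this
  have hz0 : z ≠ 0 := by rintro rfl; simp at hz; linarith
  have h1 : ‖(p.reflect n).eval z⁻¹‖ ≤ B := by
    refine Complex.norm_le_of_forall_mem_frontier_norm_le (U := Metric.ball 0 1)
      (f := fun w => (p.reflect n).eval w) Metric.isBounded_ball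
      (p.reflect n).differentiable.diffContOnCl (fun w hw => ?_) ?_
    · rw [frontier_ball _ one_ne_zero, mem_sphere_zero_iff_norm] at hw
      have hw0 : w ≠ 0 := by rintro rfl; simp at hw
      have := hr w⁻¹ (inv_ne_zero hw0)
      rw [inv_inv] at this
      have h2 := congrArg norm this
      rw [norm_mul, norm_pow, norm_inv, hw, inv_one, one_pow, mul_one] at h2
      rw [h2]
      exact hB _ (by rw [norm_inv, hw, inv_one])
    · rw [closure_ball _ one_ne_zero, mem_closedBall_zero_iff, norm_inv]
      exact inv_le_one_of_one_le₀ hz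
  rw [← hr z hz0, norm_mul, norm_pow]
  gcongr

/-- The weight dominates `log⁺ |z|² - c`. -/
theorem WeightGrowth.exists_posLog_sub_le {Q : ℂ → ℝ} (hQ : Continuous Q) (h : WeightGrowth Q) :
    ∃ c : ℝ, ∀ z, 2 * log⁺ ‖z‖ - c ≤ Q z := by
  obtain ⟨ε, hε, R, hR, h⟩ := h
  have hc : Continuous fun z : ℂ => 2 * log⁺ ‖z‖ - Q z :=
    (continuous_const.mul (continuous_posLog.comp (continuous_norm (E := ℂ)))).sub hQ
  obtain ⟨c, hc⟩ := (isCompact_closedBall (0 : ℂ) (max R 1)).bddAbove_image hc.continuousOn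
  refine ⟨max c 0, fun z => ?_⟩
  rcases le_total ‖z‖ (max R 1) with hz | hz
  · have := hc ⟨z, by simpa using hz, rfl⟩
    have := le_max_left c 0
    simp only at *
    linarith
  · have h1 : 1 ≤ ‖z‖ := (le_max_right _ _).trans hz
    have h2 := h z ((le_max_left _ _).trans hz)
    rw [posLog_eq_log (by simpa using h1)]
    rw [log_pow] at h2
    push_cast at h2
    have := mul_nonneg hε.le (log_nonneg h1)
    have := le_max_right c 0
    linarith

theorem le_equilibriumWeight {Q v : ℂ → ℝ} (hv : v ∈ subharmonicMinorants Q) (z : ℂ) :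
    v z ≤ equilibriumWeight Q z :=
  le_csSup ⟨Q z, by rintro _ ⟨w, hw, rfl⟩; exact hw.2.1 z⟩ ⟨v, hv, rfl⟩

/-- If a polynomial of degree at most `m` is bounded by `M e^{mQ}` on a large disc, then a
competitor built from it is a subharmonic minorant of the weight. -/
theorem WeightGrowth.exists_competitor_mem {Q : ℂ → ℝ} (hQ : Continuous Q) (h : WeightGrowth Q) :
    ∃ R c : ℝ, ∀ (m : ℝ) (p : ℂ[X]) (M : ℝ), 0 < m → (p.natDegree : ℝ) ≤ m → 0 < M →
      (∀ z, ‖z‖ ≤ R → ‖p.eval z‖ ^ 2 ≤ M * exp (m * Q z)) →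
        competitor p m M c ∈ subharmonicMinorants Q := by
  obtain ⟨c, hc⟩ := h.exists_posLog_sub_le hQ
  obtain ⟨ε, hε, R, hR, h⟩ := h
  obtain ⟨q, hq⟩ := (isCompact_closedBall (0 : ℂ) 1).bddAbove_image hQ.continuousOn
  have hcQ : ∀ z, -c ≤ Q z := fun z => by
    have := hc z
    have := posLog_nonneg (x := ‖z‖)
    linarith
  -- With `Q ≤ q` on the unit disc, `hout` gives growth at most `q + 2 log |z|`. Once `log |z| ≥ max
  -- q 0 / ε`, the surplus `ε` in the growth of `Q` absorbs `q`.
  refine ⟨max R (exp (max q 0 / ε)), c, fun m p M hm hpm hM hp => ?_⟩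
  have hout : ∀ z : ℂ, 1 ≤ ‖z‖ → ‖p.eval z‖ ^ 2 / M ≤ exp (m * (q + 2 * log ‖z‖)) := by
    intro z hz
    have hB : ∀ w : ℂ, ‖w‖ = 1 → ‖p.eval w‖ ≤ √(M * exp (m * q)) := fun w hw => by
      refine Real.le_sqrt_of_sq_le ((hp w ?_).trans ?_)
      · rw [hw]
        exact (one_le_exp (by positivity)).trans (le_max_right _ _)
      · have := hq ⟨w, by simp [hw], rfl⟩
        gcongr
    have h1 := norm_eval_le_of_unit_circle le_rfl hB hz
    have h2 : ‖z‖ ^ p.natDegree ≤ exp (m * log ‖z‖) := by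
      rw [← Real.exp_log (show 0 < ‖z‖ by linarith), ← Real.exp_nat_mul, log_exp]
      have := log_nonneg hz
      gcongr
    rw [div_le_iff₀ hM]
    calc ‖p.eval z‖ ^ 2 ≤ (√(M * exp (m * q)) * exp (m * log ‖z‖)) ^ 2 := by
          gcongr
          exact h1.trans (by gcongr)
      _ = exp (m * (q + 2 * log ‖z‖)) * M := by
          rw [mul_pow, Real.sq_sqrt (by positivity), ← Real.exp_nat_mul, mul_assoc, ← Real.exp_add,
            mul_comm]
          congr 2; push_cast; ring
  have hlog : ∀ {z : ℂ} {x : ℝ}, -c ≤ x → ‖p.eval z‖ ^ 2 / M ≤ exp (m * x) →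
      m⁻¹ * log (max (‖p.eval z‖ ^ 2 / M) (exp (-(m * c)))) ≤ x := fun {z x} hx hz => by
    rw [inv_mul_eq_div, div_le_iff₀ hm, Real.log_le_iff_le_exp (by positivity), mul_comm x]
    refine max_le hz (exp_le_exp.2 ?_)
    nlinarith
  refine ⟨isSubharmonic_competitor p hm hM c, fun z => ?_, ?_⟩
  · refine max_le (hc z) (hlog (hcQ z) ?_)
    rcases le_total ‖z‖ (max R (exp (max q 0 / ε))) with hz | hz
    · rw [div_le_iff₀ hM, mul_comm]
      exact hp z hz
    · have hz2 := (le_max_right _ _).trans hz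
      have h1 : 1 ≤ ‖z‖ := (one_le_exp (by positivity)).trans hz2
      refine (hout z h1).trans (exp_le_exp.2 ?_)
      have h2 := h z ((le_max_left _ _).trans hz)
      have h3 : max q 0 / ε ≤ log ‖z‖ := (Real.le_log_iff_exp_le (by linarith)).2 hz2
      rw [div_le_iff₀ hε] at h3
      rw [log_pow] at h2
      push_cast at h2
      have := le_max_left q 0
      have := le_max_right q 0
      gcongr
      nlinarith
  -- The `log⁺` branch forces the lower bound even when `deg p < m`; `hout` gives the upper one.
  · refine Asymptotics.IsBigO.of_bound (max |c| (max q 0 + |c|)) ?_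
    filter_upwards [eventually_cobounded_le_norm (1 : ℝ)] with z hz
    have hl := log_nonneg hz
    rw [norm_one, mul_one, Real.norm_eq_abs, log_pow, competitor,
      posLog_eq_log (by simpa using hz)]
    push_cast
    have h1 : m⁻¹ * log (max (‖p.eval z‖ ^ 2 / M) (exp (-(m * c))))
        ≤ max q 0 + |c| + 2 * log ‖z‖ := by
      have := le_max_left q 0
      have := le_max_right q 0
      have := neg_abs_le c
      have := abs_nonneg c
      refine hlog (by linarith) ((hout z hz).trans (exp_le_exp.2 ?_))
      gcongr
      linarith
    have h2 : max (2 * log ‖z‖ - c) (m⁻¹ * log (max (‖p.eval z‖ ^ 2 / M) (exp (-(m * c)))))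
        ≤ max q 0 + |c| + 2 * log ‖z‖ := by
      refine max_le ?_ h1
      have := le_max_right q 0
      have := neg_abs_le c
      linarith
    have h3 := le_max_left (2 * log ‖z‖ - c)
      (m⁻¹ * log (max (‖p.eval z‖ ^ 2 / M) (exp (-(m * c)))))
    refine abs_le.2 ⟨?_, ?_⟩
    · have := le_max_left |c| (max q 0 + |c|)
      have := le_abs_self c
      linarith
    · have := le_max_right |c| (max q 0 + |c|)
      linarith

theorem equilibriumWeight_le {Q : ℂ → ℝ} (hQ : Continuous Q) (h : WeightGrowth Q) (z : ℂ) :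
    equilibriumWeight Q z ≤ Q z := by
  obtain ⟨R, c, hmem⟩ := h.exists_competitor_mem hQ
  refine csSup_le ?_ (by rintro _ ⟨w, hw, rfl⟩; exact hw.2.1 z)
  -- Since `sSup ∅ = 0` in `ℝ`, a minorant must be exhibited: the competitor of the zero polynomial.
  exact ⟨_, _, hmem 1 0 1 one_pos (by simp) one_pos (fun z _ => by simp; positivity), rfl⟩

/-- The Bernstein-Walsh inequality for weighted polynomials: a bound by `M e^{mQ}` on a large disc
gives a bound by `M e^{mQ̂}` in the plane. -/
theorem WeightGrowth.exists_bernstein_walsh {Q : ℂ → ℝ} (hQ : Continuous Q) (h : WeightGrowth Q) :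
    ∃ R : ℝ, ∀ (m : ℝ) (p : ℂ[X]) (M : ℝ), 0 < m → (p.natDegree : ℝ) ≤ m → 0 ≤ M →
      (∀ z, ‖z‖ ≤ R → ‖p.eval z‖ ^ 2 ≤ M * exp (m * Q z)) →
        ∀ z, ‖p.eval z‖ ^ 2 ≤ M * exp (m * equilibriumWeight Q z) := by
  obtain ⟨R, c, hmem⟩ := h.exists_competitor_mem hQ
  refine ⟨R, fun m p M hm hpm hM hp z => ?_⟩
  rw [← div_le_iff₀ (exp_pos _)]
  -- Passing to `M' > M` covers `M = 0`, where no competitor can be formed.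
  refine le_of_forall_gt_imp_ge_of_dense fun M' hM' => ?_
  have h0 : 0 < M' := hM.trans_lt hM'
  have h1 := le_equilibriumWeight (hmem m p M' hm hpm h0 fun w hw =>
    (hp w hw).trans (by gcongr)) z
  have h2 := (le_max_right _ _).trans h1
  rw [inv_mul_eq_div, div_le_iff₀ hm, Real.log_le_iff_le_exp (by positivity)] at h2
  have h3 := (le_max_left _ _).trans h2
  rw [div_le_iff₀ h0] at h3
  rw [div_le_iff₀ (exp_pos _), mul_comm M', mul_comm m]
  exact h3

end Polyanalytic

/-! ### Local estimates for bianalytic functions. -/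

namespace Polyanalytic

open MeasureTheory ComplexConjugate Real Set

theorem norm_circleAverage_sq_le {f : ℂ → ℂ} (hf : Continuous f) (c : ℂ) (r : ℝ) :
    ‖circleAverage f c r‖ ^ 2 ≤ circleAverage (fun z => ‖f z‖ ^ 2) c r := by
  have hconv : ConvexOn ℝ univ fun w : ℂ => ‖w‖ ^ 2 :=
    (convexOn_norm convex_univ).pow (fun _ _ => norm_nonneg _) 2
  have hθ : Continuous fun θ => f (circleMap c r θ) := hf.comp (continuous_circleMap c r)
  rw [circleAverage_eq_intervalAverage, circleAverage_eq_intervalAverage]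
  refine hconv.map_set_average_le (by fun_prop) isClosed_univ ?_ ?_ (by simp)
    (hθ.intervalIntegrable 0 (2 * π)).def' ((hθ.norm.pow 2).intervalIntegrable 0 (2 * π)).def'
  · simp [uIoc_of_le two_pi_pos.le, pi_pos]
  · simpa [uIoc_of_le two_pi_pos.le] using ENNReal.mul_ne_top ENNReal.ofNat_ne_top
      ENNReal.ofReal_ne_top

theorem circleAverage_of_differentiable {F : ℂ → ℂ} (hF : Differentiable ℂ F) (c : ℂ) (r : ℝ) :
    circleAverage F c r = F c :=
  hF.diffContOnCl.circleAverage

theorem conj_sub_mul_sub_of_mem_sphere {z c : ℂ} {r : ℝ} (hz : z ∈ Metric.sphere c |r|) :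
    conj (z - c) * (z - c) = (r : ℂ) ^ 2 := by
  rw [Complex.conj_mul', ← dist_eq_norm, Metric.mem_sphere.1 hz]
  norm_cast
  exact sq_abs r

/-- On the circle `conj (z - c) * (z - c) = r²`, so the factor `z - c` makes the integrand
holomorphic and isolates `G c`. -/
theorem circleAverage_sub_mul_bianalytic {F G : ℂ → ℂ} (hF : Differentiable ℂ F)
    (hG : Differentiable ℂ G) (c : ℂ) (r : ℝ) :
    circleAverage (fun z => (z - c) * (F z + conj (z - c) * G z)) c r = r ^ 2 * G c := by
  rw [circleAverage_congr_sphere (f₂ := fun z => (z - c) * F z + (r : ℂ) ^ 2 * G z)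
    fun z hz => ?_]
  · rw [circleAverage_of_differentiable (by fun_prop)]
    simp
  · simp only [← conj_sub_mul_sub_of_mem_sphere hz]
    ring

theorem circleAverage_conj_sub (c : ℂ) (r : ℝ) : circleAverage (fun z => conj (z - c)) c r = 0 := by
  have h := Complex.conjCLE.toContinuousLinearMap.circleAverage_comp_comm
    (f := fun z : ℂ => z - c) (c := c) (R := r)
    (Continuous.continuousOn (by fun_prop)).circleIntegrable'
  rw [circleAverage_of_differentiable (F := fun z => z - c) (by fun_prop)] at h
  simpa [Function.comp_def] using h

/-- Split `G = G c + (z - c) * dslope G c`: the constant part has mean zero against `conj (z - c)`,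
the rest becomes `r²` times a holomorphic function. Two radii then eliminate the `dslope` term. -/
theorem circleAverage_bianalytic {F G : ℂ → ℂ} (hF : Differentiable ℂ F)
    (hG : Differentiable ℂ G) (c : ℂ) (r : ℝ) :
    circleAverage (fun z => F z + conj (z - c) * G z) c r = F c + r ^ 2 * dslope G c c := by
  have hd : Differentiable ℂ (dslope G c) := by
    rw [← differentiableOn_univ] at hG ⊢
    exact (Complex.differentiableOn_dslope Filter.univ_mem).2 hG
  have hi : ∀ {f : ℂ → ℂ}, Continuous f → CircleIntegrable f c r := fun hf =>
    hf.continuousOn.circleIntegrable'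
  have hF' : Differentiable ℂ fun z => F z + (r : ℂ) ^ 2 * dslope G c z := by fun_prop
  have hc : Continuous fun z : ℂ => G c • conj (z - c) := by fun_prop
  rw [circleAverage_congr_sphere
    (f₂ := fun z => (F z + (r : ℂ) ^ 2 * dslope G c z) + G c • conj (z - c)) fun z hz => ?_]
  · rw [circleAverage_fun_add (hi hF'.continuous) (hi hc), circleAverage_of_differentiable hF',
      circleAverage_fun_smul, circleAverage_conj_sub, smul_zero, add_zero]
  · have h := sub_smul_dslope G c z
    rw [smul_eq_mul] at h
    simp only [← conj_sub_mul_sub_of_mem_sphere hz, smul_eq_mul]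
    linear_combination -(conj (z - c)) * h

/-- Integration over a disc in polar coordinates. -/
theorem setIntegral_ball_eq_circleAverage {f : ℂ → ℝ} (hf : Continuous f) (c : ℂ) {ρ : ℝ}
    (hρ : 0 ≤ ρ) :
    ∫ z in Metric.ball c ρ, f z = ∫ r in 0..ρ, 2 * π * r * circleAverage f c r := by
  have h1 : ∫ z in Metric.ball c ρ, f z
      = ∫ z, (Metric.ball (0 : ℂ) ρ).indicator (fun z => f (z + c)) z := by
    rw [← integral_indicator Metric.isOpen_ball.measurableSet,
      ← integral_add_right_eq_self _ c]
    congr 1; ext z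
    simp [indicator, Metric.mem_ball]
  have hcont : Continuous fun p : ℝ × ℝ => p.1 * f (circleMap c p.1 p.2) := by
    have := hf.comp (circleMap.continuous (c := c))
    exact continuous_fst.mul this
  have h2 : ∫ z, (Metric.ball (0 : ℂ) ρ).indicator (fun z => f (z + c)) z
      = ∫ p in Ioo 0 ρ ×ˢ Ioo (-π) π, p.1 * f (circleMap c p.1 p.2) := by
    rw [← Complex.integral_comp_polarCoord_symm, ← integral_indicator
      polarCoord.open_target.measurableSet, ← integral_indicator
      (measurableSet_Ioo.prod measurableSet_Ioo)]
    congr 1; ext ⟨r, θ⟩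
    by_cases hr : 0 < r
    · have : (r * (Complex.cos θ + Complex.sin θ * Complex.I) : ℂ) + c = circleMap c r θ := by
        rw [circleMap, Complex.exp_mul_I, add_comm]
      simp [indicator, polarCoord_target, hr, abs_of_pos hr, -Complex.ofReal_cos,
        -Complex.ofReal_sin]
      split_ifs <;> simp_all
    · simp [indicator, polarCoord_target, hr]
  rw [h1, h2, Measure.volume_eq_prod, setIntegral_prod, intervalIntegral.integral_of_le hρ,
    integral_Ioc_eq_integral_Ioo]
  · refine setIntegral_congr_fun measurableSet_Ioo fun r _ => ?_
    have hper : ∫ θ in (-π)..π, f (circleMap c r θ) = ∫ θ in 0..2 * π, f (circleMap c r θ) := by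
      have := ((periodic_circleMap c r).comp f).intervalIntegral_add_eq (-π) 0
      rw [zero_add, show -π + 2 * π = π by ring] at this
      exact this
    simp only
    rw [integral_const_mul, ← integral_Ioc_eq_integral_Ioo,
      ← intervalIntegral.integral_of_le (by linarith [pi_pos]), hper, circleAverage, smul_eq_mul]
    field_simp
  · rw [← Measure.volume_eq_prod]
    exact (hcont.continuousOn.integrableOn_compact
      ((isCompact_Icc (a := (0 : ℝ)) (b := ρ)).prod (isCompact_Icc (a := -π) (b := π)))).mono_set
      (prod_mono Ioo_subset_Icc_self Ioo_subset_Icc_self)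

/-- The local mean value estimates for a bianalytic function. -/
theorem bianalytic_local_estimate {F G : ℂ → ℂ} (hF : Differentiable ℂ F)
    (hG : Differentiable ℂ G) (c : ℂ) {ρ : ℝ} (hρ : 0 < ρ) :
    ‖F c‖ ^ 2 * (π * ρ ^ 2) ≤ 15 * ∫ z in Metric.ball c ρ, ‖F z + conj (z - c) * G z‖ ^ 2 ∧
    ‖G c‖ ^ 2 * (π * ρ ^ 4) ≤ 2 * ∫ z in Metric.ball c ρ, ‖F z + conj (z - c) * G z‖ ^ 2 := by
  have hu : Continuous fun z => F z + conj (z - c) * G z := by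
    have := hF.continuous
    have := hG.continuous
    fun_prop
  set A : ℝ → ℝ := fun r => circleAverage (fun z => ‖F z + conj (z - c) * G z‖ ^ 2) c r with hA
  have hAc : Continuous A := (hu.norm.pow 2).circleAverage
  have hA0 : ∀ r, 0 ≤ A r := fun r => circleAverage_nonneg_of_nonneg fun z _ => by positivity
  have hpolar := setIntegral_ball_eq_circleAverage
    (f := fun z => ‖F z + conj (z - c) * G z‖ ^ 2) (hu.norm.pow 2) c hρ.le
  have hN : ∫ z in Metric.ball c ρ, ‖F z + conj (z - c) * G z‖ ^ 2
      = 2 * π * ∫ r in 0..ρ, r * A r := by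
    rw [hpolar, ← intervalIntegral.integral_const_mul]
    simp only [mul_assoc, hA]
  rw [hN]
  have hgi : ∀ a b : ℝ, IntervalIntegrable (fun r => r * A r) volume a b := fun a b =>
    (continuous_id.mul hAc).intervalIntegrable a b
  constructor
  -- The means `b` at radius `r / 2` and `a` at radius `r` satisfy `4 b - a = 3 F c`; then `(x + y)²
  -- ≤ 2 x² + 2 y²`.
  · have key : ∀ r, 9 * ‖F c‖ ^ 2 ≤ 32 * A (r / 2) + 2 * A r := fun r => by
      have h1 := circleAverage_bianalytic hF hG c r
      have h2 := circleAverage_bianalytic hF hG c (r / 2)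
      have h3 := norm_circleAverage_sq_le hu c r
      have h4 := norm_circleAverage_sq_le hu c (r / 2)
      set a := circleAverage (fun z => F z + conj (z - c) * G z) c r
      set b := circleAverage (fun z => F z + conj (z - c) * G z) c (r / 2)
      have h5 : 3 * F c = 4 * b - a := by
        rw [h1, h2]; push_cast; ring
      have h6 : 3 * ‖F c‖ ≤ 4 * ‖b‖ + ‖a‖ := by
        have := norm_sub_le (4 * b) a
        rw [← h5] at this
        simpa using this
      have h7 : (3 * ‖F c‖) ^ 2 ≤ (4 * ‖b‖ + ‖a‖) ^ 2 := by gcongr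
      simp only [hA]
      nlinarith [sq_nonneg (4 * ‖b‖ - ‖a‖)]
    have hi : ∀ a b : ℝ, IntervalIntegrable (fun r => r * A (r / 2)) volume a b := fun a b =>
      (continuous_id.mul (hAc.comp (continuous_id.div_const 2))).intervalIntegrable a b
    have h1 : ∫ r in 0..ρ, r * A (r / 2) = 4 * ∫ r in 0..ρ / 2, r * A r := by
      have := intervalIntegral.integral_comp_div (a := 0) (b := ρ) (fun r => 2 * (r * A r))
        (two_ne_zero (α := ℝ))
      rw [intervalIntegral.integral_const_mul, zero_div, smul_eq_mul,
        intervalIntegral.integral_const_mul] at this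
      rw [show (4 : ℝ) * ∫ r in 0..ρ / 2, r * A r = 2 * (2 * ∫ r in 0..ρ / 2, r * A r) by ring,
        ← this, ← intervalIntegral.integral_const_mul]
      refine intervalIntegral.integral_congr fun r _ => ?_
      ring
    have h2 : ∫ r in 0..ρ / 2, r * A r ≤ ∫ r in 0..ρ, r * A r := by
      refine intervalIntegral.integral_mono_interval le_rfl (by positivity) (by linarith) ?_
        (hgi 0 ρ)
      filter_upwards [ae_restrict_mem measurableSet_Ioc] with r hr
      exact mul_nonneg hr.1.le (hA0 r)
    have h3 : ∫ r in 0..ρ, r * (9 * ‖F c‖ ^ 2)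
        ≤ ∫ r in 0..ρ, (32 * (r * A (r / 2)) + 2 * (r * A r)) := by
      refine intervalIntegral.integral_mono_on hρ.le
        (continuous_id.mul continuous_const |>.intervalIntegrable 0 ρ)
        (((hi 0 ρ).const_mul 32).add ((hgi 0 ρ).const_mul 2)) fun r hr => ?_
      have := mul_le_mul_of_nonneg_left (key r) hr.1
      linarith
    rw [intervalIntegral.integral_add ((hi 0 ρ).const_mul 32) ((hgi 0 ρ).const_mul 2),
      intervalIntegral.integral_const_mul, intervalIntegral.integral_const_mul,
      intervalIntegral.integral_mul_const, integral_id, h1] at h3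
    have h4 : 0 ≤ ∫ r in 0..ρ, r * A r :=
      intervalIntegral.integral_nonneg hρ.le fun r hr => mul_nonneg hr.1 (hA0 r)
    -- The exact constant is `2 * (4 * 32 + 2) / 9 = 260 / 9`.
    have h5 : ‖F c‖ ^ 2 * ρ ^ 2 ≤ 30 * ∫ r in 0..ρ, r * A r := by linarith
    nlinarith [mul_le_mul_of_nonneg_left h5 pi_pos.le]
  · have key : ∀ r, 0 ≤ r → r ^ 3 * ‖G c‖ ^ 2 ≤ r * A r := fun r hr => by
      rcases hr.eq_or_lt with rfl | hr
      · simp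
      have h1 := circleAverage_sub_mul_bianalytic hF hG c r
      have h2 := norm_circleAverage_sq_le
        (f := fun z => (z - c) * (F z + conj (z - c) * G z)) (by fun_prop) c r
      have h3 : circleAverage (fun z => ‖(z - c) * (F z + conj (z - c) * G z)‖ ^ 2) c r
          = r ^ 2 * A r := by
        rw [circleAverage_congr_sphere
          (f₂ := fun z => r ^ 2 • ‖F z + conj (z - c) * G z‖ ^ 2) fun z hz => ?_,
          circleAverage_fun_smul, smul_eq_mul]
        rw [Metric.mem_sphere, dist_eq_norm] at hz
        simp only
        rw [norm_mul, mul_pow, hz, sq_abs, smul_eq_mul]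
      rw [h1, h3, norm_mul, norm_pow, Complex.norm_real, Real.norm_eq_abs, abs_of_pos hr] at h2
      have h4 : r ^ 2 * (r ^ 2 * ‖G c‖ ^ 2) ≤ r ^ 2 * A r := by linarith [h2]
      have h5 := le_of_mul_le_mul_left h4 (by positivity)
      nlinarith [mul_le_mul_of_nonneg_left h5 hr.le]
    have h3 : ∫ r in 0..ρ, r ^ 3 * ‖G c‖ ^ 2 ≤ ∫ r in 0..ρ, r * A r :=
      intervalIntegral.integral_mono_on hρ.le
        (Continuous.intervalIntegrable (by fun_prop) 0 ρ) (hgi 0 ρ) fun r hr => key r hr.1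
    rw [intervalIntegral.integral_mul_const, integral_pow] at h3
    have h5 : ‖G c‖ ^ 2 * ρ ^ 4 ≤ 4 * ∫ r in 0..ρ, r * A r := by
      norm_num at h3; linarith
    nlinarith [mul_le_mul_of_nonneg_left h5 pi_pos.le]

/-- A `C²` function is approximated by real parts of affine functions to second order, uniformly on
a disc. -/
theorem exists_taylor_bound {Q : ℂ → ℝ} (hQ : ContDiff ℝ 2 Q) (R : ℝ) :
    ∃ A : ℝ, 0 ≤ A ∧ ∀ c : ℂ, ‖c‖ ≤ R → ∃ l : ℂ, ∀ z, ‖z - c‖ ≤ 1 →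
      Q z ≤ Q c + (l * (z - c)).re + A * ‖z - c‖ ^ 2 := by
  have hd : Differentiable ℝ Q := hQ.differentiable two_ne_zero
  have h1 : ContDiff ℝ 1 (fderiv ℝ Q) := hQ.fderiv_right (by norm_num)
  obtain ⟨K, hK⟩ := h1.contDiffOn.exists_lipschitzOnWith one_ne_zero
    (convex_closedBall (0 : ℂ) (R + 1)) (isCompact_closedBall _ _)
  -- `l = Q_x - i Q_y`, and `K` is a Lipschitz constant of the derivative on the disc enlarged by
  -- one.
  refine ⟨K, K.2, fun c hc => ⟨fderiv ℝ Q c 1 - fderiv ℝ Q c Complex.I * Complex.I,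
    fun z hz => ?_⟩⟩
  have hre : ((fderiv ℝ Q c 1 - fderiv ℝ Q c Complex.I * Complex.I : ℂ) * (z - c)).re
      = fderiv ℝ Q c (z - c) := by
    conv_rhs => rw [← Complex.re_add_im (z - c), map_add,
      show (((z - c).re : ℝ) : ℂ) = (z - c).re • (1 : ℂ) by simp,
      show (((z - c).im : ℝ) : ℂ) * Complex.I = (z - c).im • Complex.I by simp, map_smul, map_smul]
    simp only [Complex.mul_re, Complex.sub_re, Complex.sub_im, Complex.ofReal_re,
      Complex.ofReal_im, Complex.I_re, Complex.I_im, Complex.mul_im, smul_eq_mul]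
    ring
  have hmem : ∀ w ∈ Metric.closedBall c ‖z - c‖, w ∈ Metric.closedBall (0 : ℂ) (R + 1) := by
    intro w hw
    rw [Metric.mem_closedBall, dist_eq_norm] at hw
    rw [mem_closedBall_zero_iff]
    calc ‖w‖ = ‖(w - c) + c‖ := by rw [sub_add_cancel]
      _ ≤ ‖w - c‖ + ‖c‖ := norm_add_le _ _
      _ ≤ R + 1 := by linarith
  have h2 := (convex_closedBall c ‖z - c‖).norm_image_sub_le_of_norm_hasFDerivWithin_le'
    (f := Q) (f' := fderiv ℝ Q) (φ := fderiv ℝ Q c) (C := K * ‖z - c‖) (x := c) (y := z)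
    (fun w _ => (hd w).hasFDerivAt.hasFDerivWithinAt) (fun w hw => ?_)
    (Metric.mem_closedBall_self (norm_nonneg _)) (by simp [dist_eq_norm])
  · rw [hre]
    have := (le_abs_self _).trans h2
    nlinarith
  · refine (hK.norm_sub_le (hmem w hw) (hmem c (Metric.mem_closedBall_self
      (norm_nonneg _)))).trans ?_
    gcongr
    simpa [dist_eq_norm] using hw

theorem weightedNormSq_eq (Q : ℂ → ℝ) (hQ : Continuous Q) (m : ℝ) (u : ℂ → ℂ) :
    weightedNormSq Q m u = π⁻¹ * ∫ z, ‖u z‖ ^ 2 * exp (-(m * Q z)) := by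
  rw [weightedNormSq, weightedMeasure, integral_withDensity_eq_integral_toReal_smul
    (by fun_prop) (by simp), integral_smul_measure, ENNReal.toReal_ofReal (by positivity),
    smul_eq_mul]
  congr 2
  ext z
  rw [ENNReal.toReal_ofReal (exp_pos _).le, smul_eq_mul, mul_comm]

theorem integrable_norm_sq_mul_exp {Q : ℂ → ℝ} (hQ : Continuous Q) {m : ℝ} {u : ℂ → ℂ}
    (hu : MemLp u 2 (weightedMeasure Q m)) :
    Integrable (fun z => ‖u z‖ ^ 2 * exp (-(m * Q z))) := by
  have h : Integrable (fun z => ‖u z‖ ^ 2) (weightedMeasure Q m) := by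
    simpa using hu.integrable_norm_pow two_ne_zero
  rw [weightedMeasure, integrable_withDensity_iff_integrable_smul' (by fun_prop) (by simp),
    integrable_smul_measure (by simpa using pi_pos) (by simp)] at h
  refine h.congr (Filter.Eventually.of_forall fun z => ?_)
  simp only
  rw [ENNReal.toReal_ofReal (exp_pos _).le, smul_eq_mul, mul_comm]

/-- Pointwise bounds for a bianalytic function and its `∂̄`-derivative on a disc. -/
theorem exists_weighted_local_estimate {Q : ℂ → ℝ} (hQ : ContDiff ℝ 2 Q) (R : ℝ) :
    ∃ K : ℝ, 0 < K ∧ ∀ (m : ℝ) (F G : ℂ → ℂ), 1 ≤ m → Differentiable ℂ F → Differentiable ℂ G →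
      MemLp (fun z => F z + conj z * G z) 2 (weightedMeasure Q m) → ∀ c : ℂ, ‖c‖ ≤ R →
        ‖F c + conj c * G c‖ ^ 2
          ≤ K * m * weightedNormSq Q m (fun z => F z + conj z * G z) * exp (m * Q c) ∧
        ‖G c‖ ^ 2
          ≤ K * m ^ 2 * weightedNormSq Q m (fun z => F z + conj z * G z) * exp (m * Q c) := by
  obtain ⟨A, hA, hT⟩ := exists_taylor_bound hQ R
  refine ⟨15 * exp A, by positivity, fun m F G hm hF hG hu c hc => ?_⟩
  obtain ⟨l, hl⟩ := hT c hc
  have hm0 : 0 < m := by linarith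
  -- A holomorphic substitute for the weight: multiplying by `E` preserves bianalyticity, and for
  -- `|z - c| ≤ m^{-1/2}` the Taylor error `m A |z - c|²` is at most `A`.
  set E : ℂ → ℂ := fun z => Complex.exp (-(m / 2 * (l * (z - c)))) with hE
  have hEd : Differentiable ℂ E := by fun_prop
  have hEc : E c = 1 := by simp [hE]
  have hEn : ∀ z, ‖E z‖ ^ 2 = exp (-(m * (l * (z - c)).re)) := fun z => by
    rw [hE, Complex.norm_exp, ← Real.exp_nat_mul]
    congr 1
    have : (m / 2 * (l * (z - c)) : ℂ) = ((m / 2 : ℝ) : ℂ) * (l * (z - c)) := by push_cast; ring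
    rw [this, Complex.neg_re, Complex.re_ofReal_mul]
    push_cast; ring
  set u : ℂ → ℂ := fun z => F z + conj z * G z with hudef
  have hρ : (0 : ℝ) < (√m)⁻¹ := by positivity
  have hρ2 : ((√m)⁻¹) ^ 2 = m⁻¹ := by rw [inv_pow, Real.sq_sqrt hm0.le]
  have hρ1 : (√m)⁻¹ ≤ 1 := inv_le_one_of_one_le₀ (Real.one_le_sqrt.2 hm)
  -- Recentred at `c`, the holomorphic part is `F + c̄ G`, whose value at `c` is `u c`. With `ρ² = 1
  -- / m` the bounds cost `m` and `m²`.
  obtain ⟨h1, h2⟩ := bianalytic_local_estimate (F := fun z => (F z + conj c * G z) * E z)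
    (G := fun z => G z * E z) (by fun_prop) (by fun_prop) c hρ
  have hint := integrable_norm_sq_mul_exp hQ.continuous hu
  have hN : ∫ z in Metric.ball c (√m)⁻¹,
      ‖(F z + conj c * G z) * E z + conj (z - c) * (G z * E z)‖ ^ 2
      ≤ exp A * exp (m * Q c) * (π * weightedNormSq Q m u) := by
    have hpt : ∀ z ∈ Metric.ball c (√m)⁻¹,
        ‖(F z + conj c * G z) * E z + conj (z - c) * (G z * E z)‖ ^ 2
        ≤ exp A * exp (m * Q c) * (‖u z‖ ^ 2 * exp (-(m * Q z))) := fun z hz => by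
      rw [Metric.mem_ball, dist_eq_norm] at hz
      have e1 : (F z + conj c * G z) * E z + conj (z - c) * (G z * E z) = u z * E z := by
        rw [hudef, map_sub]; ring
      rw [e1, norm_mul, mul_pow, hEn]
      have e2 : exp (-(m * (l * (z - c)).re)) ≤ exp (A + m * Q c + -(m * Q z)) := by
        refine exp_le_exp.2 ?_
        have h3 := hl z (hz.le.trans hρ1)
        have h4 : m * ‖z - c‖ ^ 2 ≤ 1 := by
          calc m * ‖z - c‖ ^ 2 ≤ m * ((√m)⁻¹) ^ 2 := by gcongr
            _ = 1 := by rw [hρ2, mul_inv_cancel₀ hm0.ne']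
        have h5 := mul_le_mul_of_nonneg_left h3 hm0.le
        have h6 := mul_le_mul_of_nonneg_left h4 hA
        linarith
      calc ‖u z‖ ^ 2 * exp (-(m * (l * (z - c)).re))
          ≤ ‖u z‖ ^ 2 * exp (A + m * Q c + -(m * Q z)) := by gcongr
        _ = _ := by rw [Real.exp_add, Real.exp_add]; ring
    have hcont : Continuous fun z =>
        ‖(F z + conj c * G z) * E z + conj (z - c) * (G z * E z)‖ ^ 2 := by
      have := hF.continuous
      have := hG.continuous
      have := hEd.continuous
      fun_prop
    calc _ ≤ ∫ z in Metric.ball c (√m)⁻¹,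
          exp A * exp (m * Q c) * (‖u z‖ ^ 2 * exp (-(m * Q z))) :=
          setIntegral_mono_on ((hcont.continuousOn.integrableOn_compact
            (isCompact_closedBall c (√m)⁻¹)).mono_set Metric.ball_subset_closedBall)
            (hint.const_mul _).integrableOn Metric.isOpen_ball.measurableSet hpt
      _ ≤ ∫ z, exp A * exp (m * Q c) * (‖u z‖ ^ 2 * exp (-(m * Q z))) :=
          setIntegral_le_integral (hint.const_mul _)
            (Filter.Eventually.of_forall fun z => by positivity)
      _ = _ := by
          rw [integral_const_mul, weightedNormSq_eq Q hQ.continuous, mul_inv_cancel_left₀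
            pi_ne_zero]
  have hpow4 : ((√m)⁻¹) ^ 4 = (m ^ 2)⁻¹ := by
    rw [show (4 : ℕ) = 2 * 2 from rfl, pow_mul, hρ2, inv_pow]
  simp only [hEc, mul_one] at h1 h2
  rw [hρ2] at h1
  rw [hpow4] at h2
  have hnn : 0 ≤ exp A * exp (m * Q c) * (π * weightedNormSq Q m u) := by
    have : 0 ≤ weightedNormSq Q m u := integral_nonneg fun z => by positivity
    positivity
  constructor
  · have h3 := h1.trans (mul_le_mul_of_nonneg_left hN (by norm_num))
    have h4 := mul_le_mul_of_nonneg_left h3 (show 0 ≤ m * π⁻¹ by positivity)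
    field_simp at h4
    change ‖F c + conj c * G c‖ ^ 2 ≤ _
    linarith
  · have h3 : ‖G c‖ ^ 2 * (π * (m ^ 2)⁻¹)
        ≤ 15 * (exp A * exp (m * Q c) * (π * weightedNormSq Q m u)) := by linarith
    have h4 := mul_le_mul_of_nonneg_left h3 (show 0 ≤ m ^ 2 * π⁻¹ by positivity)
    field_simp at h4
    linarith

end Polyanalytic

/-! ### Freezing the conjugate variable. -/

namespace Polyanalytic

open MeasureTheory ComplexConjugate Polynomial

theorem exists_polynomials_of_mem_Pol_two {n : ℕ} {u : ℂ → ℂ} (hu : u ∈ Pol 2 n) :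
    ∃ f g : ℂ[X], f ∈ degreeLT ℂ n ∧ g ∈ degreeLT ℂ n ∧
      u = fun z => f.eval z + conj z * g.eval z := by
  induction hu using Submodule.span_induction with
  | mem u hu =>
    obtain ⟨r, hr, j, hj, rfl⟩ := hu
    have hX : (X ^ j : ℂ[X]) ∈ degreeLT ℂ n := by
      rw [mem_degreeLT, degree_X_pow]; exact_mod_cast hj
    interval_cases r
    · exact ⟨X ^ j, 0, hX, zero_mem _, by simp⟩
    · exact ⟨0, X ^ j, zero_mem _, hX, by simp⟩
  | zero => exact ⟨0, 0, zero_mem _, zero_mem _, by ext; simp⟩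
  | add u v _ _ hu hv =>
    obtain ⟨f, g, hf, hg, rfl⟩ := hu
    obtain ⟨f', g', hf', hg', rfl⟩ := hv
    exact ⟨f + f', g + g', add_mem hf hf', add_mem hg hg', by ext; simp; ring⟩
  | smul c u _ hu =>
    obtain ⟨f, g, hf, hg, rfl⟩ := hu
    exact ⟨c • f, c • g, Submodule.smul_mem _ _ hf, Submodule.smul_mem _ _ hg, by
      ext; simp; ring⟩

/-- The factor that compensates the growth in the base point stays bounded on discs. -/
theorem freezing_factor_le {R a b : ℝ} (hR : 0 ≤ R) (ha : 0 ≤ a) (haR : a ≤ R) (hb : 0 ≤ b) :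
    (1 + a + b) * (1 + a * b) / (1 + b ^ 2) ≤ 2 * (1 + R) ^ 2 := by
  rw [div_le_iff₀ (by positivity)]
  have h1 : (1 + a + b) * (1 + a * b) ≤ ((1 + R) * (1 + b)) * ((1 + R) * (1 + b)) := by
    gcongr <;> nlinarith [mul_nonneg ha hb, mul_nonneg hR hb, mul_le_mul_of_nonneg_right haR hb]
  nlinarith [mul_nonneg (sq_nonneg (1 + R)) (sq_nonneg (1 - b))]

theorem exists_pointwise_bound {Q : ℂ → ℝ} (hQ : ContDiff ℝ 2 Q) (hg : WeightGrowth Q) :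
    ∃ C : ℝ, 0 < C ∧ ∀ (m : ℝ) (n : ℕ), 1 ≤ m → (n : ℝ) ≤ m → ∀ u ∈ A2 2 Q m n, ∀ z : ℂ,
      ‖u z‖ ^ 2 ≤ C * m ^ 2 * weightedNormSq Q m u * Real.exp (m * equilibriumWeight Q z) := by
  obtain ⟨R', hR'⟩ := hg.exists_bernstein_walsh hQ.continuous
  set R := max R' 0
  obtain ⟨K, hK, hloc⟩ := exists_weighted_local_estimate hQ R
  refine ⟨K * (2 * (1 + R) ^ 2) ^ 2, by positivity, fun m n hm hn u hu a => ?_⟩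
  obtain ⟨f, g, hf, hg, rfl⟩ := exists_polynomials_of_mem_Pol_two hu.1
  set u : ℂ → ℂ := fun z => f.eval z + conj z * g.eval z with hudef
  have hN : 0 ≤ weightedNormSq Q m u := integral_nonneg fun z => by positivity
  have ha : (1 + a * conj a : ℂ) = ((1 + ‖a‖ ^ 2 : ℝ) : ℂ) := by
    rw [Complex.mul_conj']; push_cast; rfl
  have ha0 : (1 + a * conj a : ℂ) ≠ 0 := by
    rw [ha]; exact_mod_cast (by positivity : (1 + ‖a‖ ^ 2 : ℝ) ≠ 0)
  have han : ‖(1 + a * conj a : ℂ)‖ = 1 + ‖a‖ ^ 2 := by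
    rw [ha, Complex.norm_real, Real.norm_eq_abs, abs_of_nonneg (by positivity)]
  -- The linear factor is `1` at `a` and `O(1 / |a|)` on bounded sets. Its one extra degree fits
  -- because `f` and `g` have degree below `n`.
  set p : ℂ[X] := (f + C (conj a) * g) * (C (1 + a * conj a)⁻¹ * (C (conj a) * X + 1)) with hp
  have hpe : ∀ z, p.eval z
      = (f.eval z + conj a * g.eval z) * ((1 + a * conj a)⁻¹ * (conj a * z + 1)) := fun z => by
    simp [hp]
  have hdeg : p.natDegree ≤ n := by
    by_cases h0 : f + C (conj a) * g = 0
    · simp [hp, h0]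
    have h1 : (f + C (conj a) * g).natDegree < n := by
      rw [natDegree_lt_iff_degree_lt h0, ← mem_degreeLT, ← smul_eq_C_mul]
      exact add_mem hf (Submodule.smul_mem _ _ hg)
    have h2 : (C (1 + a * conj a)⁻¹ * (C (conj a) * X + 1)).natDegree ≤ 1 := by
      compute_degree
    exact natDegree_mul_le.trans (by omega)
  have hpa : p.eval a = u a := by
    rw [hpe, mul_comm (conj a) a, add_comm _ (1 : ℂ), inv_mul_cancel₀ ha0, mul_one]
  rw [← hpa, show K * (2 * (1 + R) ^ 2) ^ 2 * m ^ 2 * weightedNormSq Q m u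
    = (2 * (1 + R) ^ 2) ^ 2 * (K * m ^ 2 * weightedNormSq Q m u) by ring]
  refine hR' m p _ (by linarith) (le_trans (by exact_mod_cast hdeg) hn) (by positivity)
    (fun z hz => ?_) a
  have hzR : ‖z‖ ≤ R := hz.trans (le_max_left _ _)
  obtain ⟨h1, h2⟩ := hloc m (fun z => f.eval z) (fun z => g.eval z) hm f.differentiable
    g.differentiable hu.2 z hzR
  set B := K * m ^ 2 * weightedNormSq Q m u * Real.exp (m * Q z) with hB
  have hB0 : 0 ≤ B := by positivity
  have h1' : ‖f.eval z + conj z * g.eval z‖ ≤ √B := by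
    refine Real.le_sqrt_of_sq_le (h1.trans ?_)
    have : K * m ≤ K * m ^ 2 := by gcongr; nlinarith
    rw [hB]
    gcongr
  have h2' : ‖g.eval z‖ ≤ √B := Real.le_sqrt_of_sq_le h2
  -- Freezing changes `u z` by `(z̄ - ā) g(z)`, which is why a bound on `g` is needed.
  have h3 : ‖f.eval z + conj a * g.eval z‖ ≤ √B * (1 + ‖z‖ + ‖a‖) := by
    have e : f.eval z + conj a * g.eval z
        = (f.eval z + conj z * g.eval z) - (conj z - conj a) * g.eval z := by ring
    rw [e]
    refine (norm_sub_le _ _).trans ?_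
    rw [norm_mul]
    have h4 : ‖conj z - conj a‖ ≤ ‖z‖ + ‖a‖ := by
      simpa using norm_sub_le (conj z) (conj a)
    have h5 : ‖conj z - conj a‖ * ‖g.eval z‖ ≤ (‖z‖ + ‖a‖) * √B := by gcongr
    linarith
  have h4 : ‖conj a * z + 1‖ ≤ 1 + ‖z‖ * ‖a‖ := by
    refine (norm_add_le _ _).trans ?_
    simp [add_comm, mul_comm]
  have h5 : ‖p.eval z‖ ≤ √B * (2 * (1 + R) ^ 2) := by
    rw [hpe, norm_mul, norm_mul, norm_inv, han]
    calc _ ≤ (√B * (1 + ‖z‖ + ‖a‖)) * ((1 + ‖a‖ ^ 2)⁻¹ * (1 + ‖z‖ * ‖a‖)) := by gcongr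
      _ = √B * ((1 + ‖z‖ + ‖a‖) * (1 + ‖z‖ * ‖a‖) / (1 + ‖a‖ ^ 2)) := by ring
      _ ≤ _ := by
        gcongr
        exact freezing_factor_le (le_max_right _ _) (norm_nonneg _) hzR (norm_nonneg _)
  calc ‖p.eval z‖ ^ 2 ≤ (√B * (2 * (1 + R) ^ 2)) ^ 2 := by gcongr
    _ = _ := by rw [mul_pow, Real.sq_sqrt hB0, hB]; ring

/-! ### From the pointwise bound to the kernel. -/

/-- A pointwise bound on `A²` bounds the diagonal of the reproducing kernel. -/
theorem bergmanKernel_self_re_le {q n : ℕ} {Q : ℂ → ℝ} (hQ : Continuous Q) {m : ℝ} {z : ℂ} {B : ℝ}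
    (hB : 0 ≤ B) (h : ∀ u ∈ A2 q Q m n, ‖u z‖ ^ 2 ≤ B * weightedNormSq Q m u) :
    (bergmanKernel q Q m n z z).re ≤ B := by
  obtain ⟨d, e, he⟩ := exists_isOrthonormalBasis q hQ m n
  rw [bergmanKernel_self he, Complex.ofReal_re]
  set k : ℝ := ∑ j, ‖e j z‖ ^ 2 with hk
  have hk0 : 0 ≤ k := Finset.sum_nonneg fun j _ => by positivity
  -- The extremal function `u = K(·, z)` has `u z = ‖u‖² = k`, so the hypothesis reads `k² ≤ B k`.
  set u : ℂ → ℂ := ∑ j, conj (e j z) • e j with hudef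
  have hu : u ∈ A2 q Q m n :=
    Submodule.sum_mem _ fun j _ => Submodule.smul_mem _ _ (he.mem j)
  have huz : u z = (k : ℂ) := by
    simp [hudef, hk, Complex.conj_mul']
  have hin : ∀ i, weightedInner Q m u (e i) = conj (e i z) := fun i => by
    have h1 : weightedInner Q m u (e i) = ∑ j, conj (e j z) * weightedInner Q m (e j) (e i) := by
      simp only [weightedInner, ← integral_const_mul]
      rw [← integral_finsetSum _
        fun j _ => (integrable_inner (he.mem j).2 (he.mem i).2).const_mul _]
      congr 1; ext w; simp [hudef, Finset.sum_mul, mul_assoc]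
    simp [h1, he.2]
  have huu : weightedInner Q m u u = (k : ℂ) := by
    have h1 : weightedInner Q m u u = ∑ j, e j z * weightedInner Q m u (e j) := by
      simp only [weightedInner, ← integral_const_mul]
      rw [← integral_finsetSum _
        fun j _ => (integrable_inner hu.2 (he.mem j).2).const_mul _]
      congr 1; ext w
      conv_lhs => rw [show conj (u w) = ∑ j, e j z * conj (e j w) by simp [hudef]]
      rw [Finset.mul_sum]
      exact Finset.sum_congr rfl fun j _ => by ring
    simp [h1, hin, hk, Complex.mul_conj']
  have hnorm : weightedNormSq Q m u = k := by
    have h1 : weightedInner Q m u u = ((weightedNormSq Q m u : ℝ) : ℂ) := by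
      rw [weightedInner, weightedNormSq, ← integral_complex_ofReal]
      congr 1; ext w; rw [Complex.mul_conj']; push_cast; rfl
    rw [h1] at huu
    exact_mod_cast huu
  have h1 := h u hu
  rw [huz, hnorm, Complex.norm_real, Real.norm_eq_abs, sq_abs, sq] at h1
  rcases hk0.eq_or_lt with h0 | h0
  · rwa [← h0]
  · exact le_of_mul_le_mul_right h1 h0

/-- Half of the decay is spent on `m²`, through `x² / 2 ≤ exp x` at `x = δ m / 2`. -/
theorem sq_mul_exp_neg_le {m δ : ℝ} (hm : 0 ≤ m) (hδ : 0 < δ) :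
    m ^ 2 * Real.exp (-(m * δ)) ≤ 8 / δ ^ 2 * Real.exp (-(δ / 2 * m)) := by
  have h1 := Real.quadratic_le_exp_of_nonneg (show 0 ≤ δ / 2 * m by positivity)
  have h2 : m ^ 2 ≤ 8 / δ ^ 2 * Real.exp (δ / 2 * m) := by
    rw [div_mul_eq_mul_div, le_div_iff₀ (by positivity)]
    nlinarith [show 0 ≤ δ / 2 * m by positivity]
  calc m ^ 2 * Real.exp (-(m * δ))
      ≤ 8 / δ ^ 2 * Real.exp (δ / 2 * m) * Real.exp (-(m * δ)) := by gcongr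
    _ = _ := by rw [mul_assoc, ← Real.exp_add]; congr 2; ring

end Polyanalytic

theorem mainTheorem8 (Q : ℂ → ℝ) (hQ : ContDiff ℝ 2 Q) (hgrowth : Polyanalytic.WeightGrowth Q) :
    (∃ C : ℝ, 0 < C ∧ ∀ (m : ℝ) (n : ℕ), 1 ≤ m → (n : ℝ) ≤ m →
      (∀ u ∈ Polyanalytic.A2 2 Q m n, ∀ z : ℂ,
        ‖u z‖ ^ 2 ≤ C * m ^ 2 * Polyanalytic.weightedNormSq Q m u *
          Real.exp (m * Polyanalytic.equilibriumWeight Q z)) ∧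
      (∀ z : ℂ, Polyanalytic.onePointFunction 2 Q m n z ≤
        C * m ^ 2 * Real.exp (-(m * (Q z - Polyanalytic.equilibriumWeight Q z))))) ∧
    (∀ z : ℂ, z ∉ Polyanalytic.droplet Q →
      ∃ c C' : ℝ, 0 < c ∧ 0 < C' ∧ ∀ (m : ℝ) (n : ℕ), 1 ≤ m → (n : ℝ) ≤ m →
        Polyanalytic.onePointFunction 2 Q m n z ≤ C' * Real.exp (-(c * m))) := by
  obtain ⟨C, hC, hpt⟩ := Polyanalytic.exists_pointwise_bound hQ hgrowth
  have hker : ∀ (m : ℝ) (n : ℕ), 1 ≤ m → (n : ℝ) ≤ m → ∀ z : ℂ,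
      Polyanalytic.onePointFunction 2 Q m n z ≤
        C * m ^ 2 * Real.exp (-(m * (Q z - Polyanalytic.equilibriumWeight Q z))) := by
    intro m n hm hn z
    have h := Polyanalytic.bergmanKernel_self_re_le (q := 2) (n := n) hQ.continuous (m := m)
      (z := z) (B := C * m ^ 2 * Real.exp (m * Polyanalytic.equilibriumWeight Q z))
      (by positivity) fun u hu => (hpt m n hm hn u hu z).trans_eq (by ring)
    refine (mul_le_mul_of_nonneg_right h (Real.exp_pos _).le).trans_eq ?_
    rw [mul_assoc, ← Real.exp_add]
    congr 2; ring
  refine ⟨⟨C, hC, fun m n hm hn => ⟨hpt m n hm hn, hker m n hm hn⟩⟩, fun z hz => ?_⟩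
  have hδ : 0 < Q z - Polyanalytic.equilibriumWeight Q z :=
    sub_pos.2 (lt_of_le_of_ne (Polyanalytic.equilibriumWeight_le hQ.continuous hgrowth z)
      fun h => hz h.symm)
  set δ := Q z - Polyanalytic.equilibriumWeight Q z
  refine ⟨δ / 2, C * (8 / δ ^ 2), by positivity, by positivity, fun m n hm hn => ?_⟩
  refine (hker m n hm hn z).trans ?_
  rw [mul_assoc, mul_assoc]
  exact mul_le_mul_of_nonneg_left (Polyanalytic.sq_mul_exp_neg_le (by linarith) hδ) hC.le
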